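/- Let $X$ be a finite cell complex, given by its finitely many cells, their dimensions and integer incidence numbers $[\sigma:\tau]$, where $[\sigma:\tau]\neq 0$ only if $\dim\sigma=\dim\tau+1$ and $\sum_\tau[\sigma:\tau][\tau:\rho]=0$ for all cells $\sigma,\rho$ (finite simplicial and cubical complexes, and finite CW complexes with their cellular chains, are examples). A subcomplex is a set of cells that contains, with each $\sigma$, every $\tau$ with $[\sigma:\tau]\ne0$. The homology $H_q(A;R)$ of a subcomplex $A$ and the relative homology $H_q(B,A;R)$ of subcomplexes $A\subseteq B$ are those of the chain complexes $C(A;R)$ and $C(B;R)/C(A;R)$ with boundary operator $\partial\sigma=\sum_\tau[\sigma:\tau]\tau$, for a commutative ring $R$. Let $T$ be a totally ordered set with least element $0$ (for instance $T=\{0,\dots,N\}$ or $T=[0,\infty)$), and let $\mathbb X=(X_t)_{t\in T}$ be a filtration of $X$: each $X_t$ is a subcomplex of $X$, $X_s\subseteq X_t$ for $s\le t$, $X_0=\emptyset$, and, for every cell $\sigma$ that lies in some $X_t$, the set $\{t\in T:\sigma\in X_t\}$ has a least element (right-continuity; automatic for $T=\{0,\dots,N\}$). For a field $\Bbbk$,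 the $q$-th persistence diagram $D_q(\mathbb X;\Bbbk)$ is the multiset $\{(b_i,d_i)\}_{i=1}^L$ of the pairs $0<b_i<d_i\le\infty$, $b_i\in T$, $d_i\in T\cup\{\infty\}$, in an interval decomposition $\bigl(H_q(X_t;\Bbbk)\bigr)_{t\in T}\cong\bigoplus_{i=1}^L I(b_i,d_i)$ of persistence modules (with the maps $H_q(X_s;\Bbbk)\to H_q(X_t;\Bbbk)$, $s\le t$, induced by inclusion). Here $I(b,d)$ is $\Bbbk$ at all $t$ with $b\le t<d$ and $0$ elsewhere, with identity maps between the copies of $\Bbbk$ and zero maps otherwise. We say that $D_q(\mathbb X;\Bbbk)$ is independent of the choice of $\Bbbk$ if one and the same multiset is the $q$-th persistence diagram for every $\Bbbk$ among $\mathbb C$, $\mathbb R$, $\mathbb Q$ and $\mathbb Z/p$, $p$ prime. Let $M$ be a non-negative integer. Then $D_q(\mathbb X;\Bbbk)$ is independent of the choice of $\Bbbk$ for all $q=0,\dots,M$ if and only if $H_q(X_n,X_m;\mathbb Z)$ is a free $\mathbb Z$-module for all $m<n$ in $T$ and all $q=0,\dots,M$. -/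

import Mathlib

open scoped DirectSum

universe u v w

/-! ### Finite cell complexes -/

/-- A finite cell complex, given by its finitely many cells, their dimensions and the integer
incidence numbers `[σ : τ]`, i.e. the entries of its boundary matrix `∂ σ = ∑ τ, [σ : τ] τ`
(which lowers the dimension by one and squares to zero).
Finite simplicial complexes (`CellComplex.ofSimplicial`) and finite cubical complexes
(`CellComplex.ofCubical`) are special cases; for a finite CW complex, `[σ : τ]` is the degree with
which `σ` is attached along `τ`. -/
structure CellComplex where
  cell : Type u
  [fintypeCell : Fintype cell]
  dim : cell → ℕ
  incidence : cell → cell → ℤ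
  dim_eq_of_incidence_ne_zero : ∀ σ τ, incidence σ τ ≠ 0 → dim σ = dim τ + 1
  sum_incidence_mul_incidence : ∀ σ ρ, ∑ τ, incidence σ τ * incidence τ ρ = 0

namespace CellComplex

attribute [instance] CellComplex.fintypeCell

section Homology

variable (X : CellComplex.{u}) (R : Type v) [CommRing R]

/-- A set of cells is a subcomplex if it contains, with each cell, every cell occurring in the
boundary of that cell. -/
def IsSubcomplex (A : Set X.cell) : Prop :=
  ∀ σ ∈ A, ∀ τ, X.incidence σ τ ≠ 0 → τ ∈ A

/-- The boundary operator `∂ σ = ∑ τ, [σ : τ] τ` on chains `∑ σ, c_σ σ` (of all degrees) with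
coefficients in `R`. A chain is given by its coefficients `c_σ`. -/
noncomputable def boundary : (X.cell → R) →ₗ[R] (X.cell → R) :=
  Matrix.mulVecLin (Matrix.of fun τ σ => (X.incidence σ τ : R))

/-- The chains, of all degrees, supported on a set `S` of cells. -/
def chainsOn (S : Set X.cell) : Submodule R (X.cell → R) where
  carrier := {c | ∀ σ, σ ∉ S → c σ = 0}
  add_mem' hc hc' σ hσ := by simp [hc σ hσ, hc' σ hσ]
  zero_mem' _ _ := rfl
  smul_mem' r c hc σ hσ := by simp [hc σ hσ]

/-- `C_q(A; R)`: the chains supported on the `q`-dimensional cells of `A`. -/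
def chains (A : Set X.cell) (q : ℕ) : Submodule R (X.cell → R) :=
  X.chainsOn R {σ | σ ∈ A ∧ X.dim σ = q}

/-- The relative cycles `{c ∈ C_q(B; R) | ∂ c is a chain of A}`. -/
noncomputable def relCycles (B A : Set X.cell) (q : ℕ) : Submodule R (X.cell → R) :=
  X.chains R B q ⊓ (X.chainsOn R A).comap (X.boundary R)

/-- The relative boundaries `∂ C_{q+1}(B; R) + C_q(A; R)`. -/
noncomputable def relBoundaries (B A : Set X.cell) (q : ℕ) : Submodule R (X.cell → R) :=
  (X.chains R B (q + 1)).map (X.boundary R) ⊔ X.chains R A q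

/-- The relative homology `H_q(B, A; R)`, i.e. the `q`-th homology of `C(B; R) / C(A; R)`:
relative cycles modulo relative boundaries. -/
abbrev RelHomology (B A : Set X.cell) (q : ℕ) : Type (max u v) :=
  X.relCycles R B A q ⧸ (X.relBoundaries R B A q).submoduleOf (X.relCycles R B A q)

/-- The homology `H_q(A; R) = H_q(A, ∅; R)`, i.e. cycles of `A` modulo boundaries of `A`. -/
abbrev Homology (A : Set X.cell) (q : ℕ) : Type (max u v) :=
  X.RelHomology R A ∅ q

variable {X}

theorem chains_mono {A B : Set X.cell} (h : A ⊆ B) (q : ℕ) : X.chains R A q ≤ X.chains R B q :=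
  fun _ hc σ hσ => hc σ fun hσ' => hσ ⟨h hσ'.1, hσ'.2⟩

theorem relCycles_mono {A B : Set X.cell} (h : A ⊆ B) (q : ℕ) :
    X.relCycles R A ∅ q ≤ X.relCycles R B ∅ q :=
  inf_le_inf_right _ (chains_mono R h q)

theorem relBoundaries_mono {A B : Set X.cell} (h : A ⊆ B) (q : ℕ) :
    X.relBoundaries R A ∅ q ≤ X.relBoundaries R B ∅ q :=
  sup_le_sup_right (Submodule.map_mono (chains_mono R h (q + 1))) _

/-- The homomorphism `H_q(A; R) → H_q(B; R)` induced by an inclusion `A ⊆ B`, `[z] ↦ [z]`. -/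
noncomputable def homologyMap {A B : Set X.cell} (h : A ⊆ B) (q : ℕ) :
    X.Homology R A q →ₗ[R] X.Homology R B q :=
  Submodule.mapQ _ _ (Submodule.inclusion (relCycles_mono R h q))
    fun _ hz => relBoundaries_mono R h q hz

end Homology

end CellComplex

/-! ### Simplicial and cubical complexes as cell complexes -/

namespace CellComplex

theorem sum_sum_eq_zero_of_antisymm {ι : Type*} (s : Finset ι) (g : ι → ι → ℤ)
    (h : ∀ i ∈ s, ∀ j ∈ s, g i j = -g j i) : ∑ i ∈ s, ∑ j ∈ s, g i j = 0 := by
  have h1 : ∑ i ∈ s, ∑ j ∈ s, g i j = -∑ i ∈ s, ∑ j ∈ s, g i j := by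
    conv_lhs => rw [Finset.sum_comm]
    rw [← Finset.sum_neg_distrib]
    refine Finset.sum_congr rfl fun i hi => ?_
    rw [← Finset.sum_neg_distrib]
    exact Finset.sum_congr rfl fun j hj => h j hj i hi
  omega

section Simplicial

variable {V : Type u} [LinearOrder V]

/-- The incidence number of two simplices with ordered vertices: `(-1)^i` if `t` arises from `s`
by removing its `i`-th vertex (counted from `0`), and `0` if `t` is not a facet of `s`. -/
def simplexIncidence (s t : Finset V) : ℤ :=
  ∑ v ∈ s, if s.erase v = t then (-1) ^ (s.filter (· < v)).card else 0

theorem simplexSign_antisymm (s : Finset V) {v w : V} (hv : v ∈ s) (hw : w ∈ s) (h : v ≠ w) :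
    (-1 : ℤ) ^ (s.filter (· < v)).card * (-1) ^ ((s.erase v).filter (· < w)).card =
      -((-1) ^ (s.filter (· < w)).card * (-1) ^ ((s.erase w).filter (· < v)).card) := by
  wlog hvw : v < w generalizing v w
  · rw [this hw hv h.symm (lt_of_le_of_ne (not_lt.1 hvw) h.symm), neg_neg]
  have h1 : (s.erase w).filter (· < v) = s.filter (· < v) := by
    ext x
    simp only [Finset.mem_filter, Finset.mem_erase]
    exact ⟨fun hx => ⟨hx.1.2, hx.2⟩, fun hx => ⟨⟨(hx.2.trans hvw).ne, hx.1⟩, hx.2⟩⟩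
  have h2 : ((s.erase v).filter (· < w)).card + 1 = (s.filter (· < w)).card := by
    rw [← Finset.card_erase_add_one (s := s.filter (· < w)) (a := v) (by simp [hv, hvw]),
      Finset.filter_erase]
  rw [h1, ← h2]
  ring

/-- A finite simplicial complex on an ordered vertex set, as a cell complex. -/
noncomputable def ofSimplicial (K : PreAbstractSimplicialComplex V) [Finite K.faces] :
    CellComplex.{u} where
  cell := K.faces
  fintypeCell := Fintype.ofFinite _
  dim s := s.1.card - 1
  incidence s t := simplexIncidence s.1 t.1
  dim_eq_of_incidence_ne_zero s t h := by
    obtain ⟨v, hv, hne⟩ := Finset.exists_ne_zero_of_sum_ne_zero h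
    have he : s.1.erase v = t.1 := by
      by_contra hc
      simp [hc] at hne
    have hc := Finset.card_erase_add_one hv
    rw [he] at hc
    have := Finset.card_pos.2 (K.isRelLowerSet_faces t.2).1
    omega
  sum_incidence_mul_incidence s r := by
    let _ : Fintype K.faces := Fintype.ofFinite _
    have key : ∑ t : K.faces, simplexIncidence s.1 t.1 * simplexIncidence t.1 r.1 =
        ∑ v ∈ s.1, ∑ w ∈ s.1, if v ≠ w ∧ (s.1.erase v).erase w = r.1 then
          (-1 : ℤ) ^ (s.1.filter (· < v)).card * (-1) ^ ((s.1.erase v).filter (· < w)).card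
          else 0 := by
      simp only [simplexIncidence, Finset.sum_mul]
      rw [Finset.sum_comm]
      refine Finset.sum_congr rfl fun v hv => ?_
      have hR : (∑ w ∈ s.1, if v ≠ w ∧ (s.1.erase v).erase w = r.1 then
          (-1 : ℤ) ^ (s.1.filter (· < v)).card * (-1) ^ ((s.1.erase v).filter (· < w)).card
          else 0) = (-1 : ℤ) ^ (s.1.filter (· < v)).card *
            simplexIncidence (s.1.erase v) r.1 := by
        rw [simplexIncidence, Finset.mul_sum, ← Finset.add_sum_erase _ _ hv]
        simp only [ne_eq, not_true_eq_false, false_and, if_false, zero_add]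
        refine Finset.sum_congr rfl fun w hw => ?_
        have : v ≠ w := (Finset.ne_of_mem_erase hw).symm
        simp [this]
      rw [hR]
      by_cases hne : (s.1.erase v).Nonempty
      · have hmem : s.1.erase v ∈ K.faces :=
          (K.isRelLowerSet_faces s.2).2 (Finset.erase_subset _ _) hne
        rw [Finset.sum_eq_single ⟨s.1.erase v, hmem⟩]
        · simp [simplexIncidence]
        · intro t _ ht
          rw [if_neg (fun hc => ht (Subtype.ext hc.symm)), zero_mul]
        · simp
      · rw [Finset.not_nonempty_iff_eq_empty] at hne
        rw [Finset.sum_eq_zero]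
        · simp [hne, simplexIncidence]
        · intro t _
          have ht := (K.isRelLowerSet_faces t.2).1
          rw [if_neg, zero_mul]
          intro hc
          rw [hne] at hc
          exact ht.ne_empty hc.symm
    rw [key]
    refine sum_sum_eq_zero_of_antisymm _ _ fun v hv w hw => ?_
    by_cases h : v = w
    · simp [h]
    · rw [Finset.erase_right_comm]
      by_cases hr : (s.1.erase w).erase v = r.1
      · rw [if_pos ⟨h, hr⟩, if_pos ⟨Ne.symm h, hr⟩]
        exact simplexSign_antisymm _ hv hw h
      · simp [hr]

end Simplicial

section Cubical

/-- An elementary cube in `ℝ^n`: the product over `i` of the intervals `[a_i, a_i + 1]` (if the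
second entry at `i` is `true`) and the points `[a_i, a_i]` (if it is `false`). -/
abbrev Cube (n : ℕ) : Type := Fin n → ℤ × Bool

namespace Cube

variable {n : ℕ}

/-- The directions in which the cube is nondegenerate. -/
def directions (s : Cube n) : Finset (Fin n) := Finset.univ.filter fun i => (s i).2 = true

/-- The face of the cube in direction `i`: the upper one for `e = 1`, the lower one
for `e = 0`. -/
def face (s : Cube n) (i : Fin n) (e : ℤ) : Cube n := Function.update s i ((s i).1 + e, false)

/-- The incidence number of two elementary cubes: if `i` is the `j`-th nondegenerate direction of
`s` (counted from `0`), the upper face of `s` in direction `i` has coefficient `(-1)^j` and the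
lower one `-(-1)^j`. -/
def incidence (s t : Cube n) : ℤ :=
  ∑ i ∈ s.directions, (-1) ^ (s.directions.filter (· < i)).card *
    ((if s.face i 1 = t then 1 else 0) - if s.face i 0 = t then 1 else 0)

theorem mem_directions (s : Cube n) (i : Fin n) : i ∈ s.directions ↔ (s i).2 = true := by
  unfold directions
  rw [Finset.mem_filter]
  exact and_iff_right (Finset.mem_univ i)

theorem directions_face (s : Cube n) (i : Fin n) (e : ℤ) :
    (s.face i e).directions = s.directions.erase i := by
  ext j
  rw [Finset.mem_erase, mem_directions, mem_directions, face]
  by_cases h : j = i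
  · subst h
    simp
  · simp [h]

theorem face_comm (s : Cube n) {i j : Fin n} (h : i ≠ j) (e e' : ℤ) :
    (s.face i e).face j e' = (s.face j e').face i e := by
  simp only [face, Function.update_of_ne h.symm, Function.update_of_ne h]
  exact Function.update_comm h _ _ _

end Cube

/-- A finite cubical complex: a finite set of elementary cubes containing all faces of its
cubes. -/
structure _root_.CubicalComplex (n : ℕ) where
  cubes : Finset (Cube n)
  face_mem : ∀ s ∈ cubes, ∀ i ∈ s.directions, s.face i 0 ∈ cubes ∧ s.face i 1 ∈ cubes

/-- A finite cubical complex, as a cell complex. -/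
def ofCubical {n : ℕ} (K : CubicalComplex n) : CellComplex.{0} where
  cell := K.cubes
  dim s := s.1.directions.card
  incidence s t := s.1.incidence t.1
  dim_eq_of_incidence_ne_zero s t h := by
    obtain ⟨i, hi, hne⟩ := Finset.exists_ne_zero_of_sum_ne_zero h
    have he : ∃ e, s.1.face i e = t.1 := by
      by_contra hc
      push Not at hc
      simp [hc] at hne
    obtain ⟨e, he⟩ := he
    rw [← he, Cube.directions_face, Finset.card_erase_add_one hi]
  sum_incidence_mul_incidence s r := by
    have hsum : ∀ u ∈ K.cubes, ∑ t : K.cubes, (if u = t.1 then (1 : ℤ) else 0) *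
        t.1.incidence r.1 = u.incidence r.1 := by
      intro u hu
      rw [Finset.sum_eq_single ⟨u, hu⟩]
      · simp
      · intro t _ ht
        rw [if_neg (fun hc => ht (Subtype.ext hc.symm)), zero_mul]
      · simp
    have key : ∑ t : K.cubes, s.1.incidence t.1 * t.1.incidence r.1 =
        ∑ i ∈ s.1.directions, ∑ j ∈ s.1.directions, if i = j then 0 else
          ((-1 : ℤ) ^ (s.1.directions.filter (· < i)).card *
            (-1) ^ ((s.1.directions.erase i).filter (· < j)).card) *
          ((if (s.1.face i 1).face j 1 = r.1 then 1 else 0) -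
            (if (s.1.face i 1).face j 0 = r.1 then 1 else 0) -
            (if (s.1.face i 0).face j 1 = r.1 then 1 else 0) +
            (if (s.1.face i 0).face j 0 = r.1 then 1 else 0)) := by
      have h1 : ∑ t : K.cubes, s.1.incidence t.1 * t.1.incidence r.1 =
          ∑ i ∈ s.1.directions, (-1 : ℤ) ^ (s.1.directions.filter (· < i)).card *
            ((s.1.face i 1).incidence r.1 - (s.1.face i 0).incidence r.1) := by
        conv_lhs => simp only [Cube.incidence, Finset.sum_mul]
        rw [Finset.sum_comm]
        refine Finset.sum_congr rfl fun i hi => ?_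
        rw [← hsum _ (K.face_mem _ s.2 i hi).1, ← hsum _ (K.face_mem _ s.2 i hi).2,
          ← Finset.sum_sub_distrib, Finset.mul_sum]
        refine Finset.sum_congr rfl fun t _ => ?_
        rw [← Cube.incidence]
        ring
      rw [h1]
      refine Finset.sum_congr rfl fun i hi => ?_
      rw [Cube.incidence, Cube.incidence, Cube.directions_face, Cube.directions_face,
        ← Finset.sum_sub_distrib, Finset.mul_sum, ← Finset.add_sum_erase _ _ hi]
      simp only [if_true, zero_add]
      refine Finset.sum_congr rfl fun j hj => ?_
      rw [if_neg (Finset.ne_of_mem_erase hj).symm]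
      ring
    rw [key]
    refine sum_sum_eq_zero_of_antisymm _ _ fun i hi j hj => ?_
    by_cases h : i = j
    · simp [h]
    · rw [if_neg h, if_neg (Ne.symm h), simplexSign_antisymm _ hi hj h,
        Cube.face_comm _ h, Cube.face_comm _ h, Cube.face_comm _ h, Cube.face_comm _ h]
      ring

end Cubical

end CellComplex

/-! ### Persistence modules and interval decompositions -/

/-- A persistence module over `k` indexed by `T`: vector spaces `V_t` and compatible linear maps
`V_s → V_t` for `s ≤ t`. -/
structure PersistenceModule (k : Type v) [Field k] (T : Type w) [LinearOrder T] where
  space : T → Type u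
  [addCommGroup : ∀ t, AddCommGroup (space t)]
  [module : ∀ t, Module k (space t)]
  map : ∀ {s t : T}, s ≤ t → space s →ₗ[k] space t
  map_refl : ∀ t, map (le_refl t) = LinearMap.id
  map_trans : ∀ {r s t : T} (hrs : r ≤ s) (hst : s ≤ t),
    (map hst).comp (map hrs) = map (hrs.trans hst)

namespace PersistenceModule

attribute [instance] PersistenceModule.addCommGroup PersistenceModule.module

section

variable (k : Type v) [Field k] {T : Type w} [LinearOrder T]

open Classical in
/-- The vector space of the interval module at time `t`: it is `k` (as the subspace `⊤` of `k`) if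
`b ≤ t < d`, and `0` otherwise. -/
noncomputable def intervalSpace (b : T) (d : WithTop T) (t : T) : Submodule k k :=
  if b ≤ t ∧ (t : WithTop T) < d then ⊤ else ⊥

open Classical in
/-- The structure map of the interval module from time `s` to time `t`: the identity of `k` if
`b ≤ s ≤ t < d`, and `0` otherwise. -/
noncomputable def intervalMap (b : T) (d : WithTop T) {s t : T} (hst : s ≤ t) :
    intervalSpace k b d s →ₗ[k] intervalSpace k b d t :=
  if h : b ≤ s ∧ (t : WithTop T) < d then
    Submodule.inclusion (show intervalSpace k b d s ≤ intervalSpace k b d t by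
      have ht : intervalSpace k b d t = ⊤ := if_pos ⟨h.1.trans hst, h.2⟩
      rw [ht]
      exact le_top)
  else 0

/-- The interval module `I(b, d)`. -/
noncomputable def interval (b : T) (d : WithTop T) : PersistenceModule.{v, v, w} k T where
  space t := intervalSpace k b d t
  map hst := intervalMap k b d hst
  map_refl t := by
    ext x
    by_cases h : b ≤ t ∧ (t : WithTop T) < d
    · simp [intervalMap, h]
    · have hx : (x : k) = 0 := by
        have hs : intervalSpace k b d t = ⊥ := if_neg h
        exact (Submodule.mem_bot k).1 (hs ▸ x.2)
      simp [intervalMap, h, hx]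
  map_trans {r s t} hrs hst := by
    have hst' : (s : WithTop T) ≤ t := WithTop.coe_le_coe.2 hst
    ext x
    by_cases h : b ≤ r ∧ (t : WithTop T) < d
    · have h1 : b ≤ r ∧ (s : WithTop T) < d := ⟨h.1, hst'.trans_lt h.2⟩
      have h2 : b ≤ s ∧ (t : WithTop T) < d := ⟨h.1.trans hrs, h.2⟩
      simp [intervalMap, h, h1, h2]
    · by_cases h1 : b ≤ r
      · have h2 : ¬ (t : WithTop T) < d := fun h2 => h ⟨h1, h2⟩
        simp [intervalMap, h2]
      · simp [intervalMap, h1]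

variable {k}

/-- The direct sum of a family of persistence modules. -/
noncomputable def directSum {ι : Type} (V : ι → PersistenceModule.{u, v, w} k T) :
    PersistenceModule.{u, v, w} k T where
  space t := ⨁ i, (V i).space t
  map hst := DirectSum.lmap fun i => (V i).map hst
  map_refl t := by
    simp only [map_refl]
    exact DirectSum.lmap_id
  map_trans hrs hst := by
    simp only [← PersistenceModule.map_trans _ hrs hst]
    exact (DirectSum.lmap_comp _ _).symm

/-- An isomorphism of persistence modules. -/
structure Iso (V : PersistenceModule.{u, v, w} k T) (W : PersistenceModule.{v, v, w} k T) where
  equiv : ∀ t, V.space t ≃ₗ[k] W.space t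
  comm : ∀ {s t : T} (hst : s ≤ t) (x : V.space s),
    equiv t (V.map hst x) = W.map hst (equiv s x)

/-- `D` is the persistence diagram of `V`: there is an interval decomposition
`V ≅ ⨁ i, I(b_i, d_i)` with `0 < b_i < d_i ≤ ∞`, and `D` is the multiset of the pairs
`(b_i, d_i)`. -/
def IsDiagram [OrderBot T] (V : PersistenceModule.{u, v, w} k T)
    (D : Multiset (T × WithTop T)) : Prop :=
  ∃ (L : ℕ) (b : Fin L → T) (d : Fin L → WithTop T),
    (∀ i, ⊥ < b i ∧ (b i : WithTop T) < d i) ∧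
    D = Finset.univ.val.map (fun i => (b i, d i)) ∧
    Nonempty (Iso V (directSum fun i => interval k (b i) (d i)))

end

end PersistenceModule

/-! ### Filtrations and their persistent homology -/

/-- A filtration `(X_t)_{t ∈ T}` of a finite cell complex by subcomplexes with `X_0 = ∅`, where `0`
is the least element of `T`; typically `T = {0, …, N}` or `T = [0, ∞)`.
The last field says that the filtration is right-continuous, so that classes are born and die
at the left ends of half-open intervals; it holds automatically for `T = {0, …, N}`. -/
structure CellComplex.Filtration (X : CellComplex.{u}) (T : Type w) [LinearOrder T]
    [OrderBot T] where
  sub : T → Set X.cell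
  isSubcomplex : ∀ t, X.IsSubcomplex (sub t)
  mono : ∀ {s t : T}, s ≤ t → sub s ⊆ sub t
  sub_bot : sub ⊥ = ∅
  exists_isLeast : ∀ t, ∀ σ ∈ sub t, ∃ b, IsLeast {s | σ ∈ sub s} b

namespace CellComplex.Filtration

variable {X : CellComplex.{u}} {T : Type w} [LinearOrder T] [OrderBot T] (F : X.Filtration T)

/-- The `q`-th persistent homology: the spaces `H_q(X_t; k)` and the maps
`H_q(X_s; k) → H_q(X_t; k)` induced by the inclusions. -/
noncomputable def persistentHomology (k : Type v) [Field k] (q : ℕ) :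
    PersistenceModule.{max u v, v, w} k T where
  space t := X.Homology k (F.sub t) q
  map hst := homologyMap k (F.mono hst) q
  map_refl t := by
    refine LinearMap.ext fun x => ?_
    obtain ⟨z, rfl⟩ := Submodule.Quotient.mk_surjective _ x
    rfl
  map_trans hrs hst := by
    refine LinearMap.ext fun x => ?_
    obtain ⟨z, rfl⟩ := Submodule.Quotient.mk_surjective _ x
    rfl

/-- The `q`-th persistence diagram does not depend on the choice of the coefficient field among
`ℂ`, `ℝ`, `ℚ` and `ℤ/p` for primes `p`: one multiset is the diagram for all these fields. -/
def DiagramIndependent (q : ℕ) : Prop :=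
  ∃ D : Multiset (T × WithTop T),
    (F.persistentHomology ℂ q).IsDiagram D ∧
    (F.persistentHomology ℝ q).IsDiagram D ∧
    (F.persistentHomology ℚ q).IsDiagram D ∧
    ∀ (p : ℕ) [Fact p.Prime], (F.persistentHomology (ZMod p) q).IsDiagram D

end CellComplex.Filtration

/-!
The theorem compares, over different fields `k`, the numbers `a_q(s, t; k)`, the dimension of the
space `∂C_{q+1}(X_t; k) + C_q(X_s; k)` of relative boundaries of the pair `(X_t, X_s)`. Both sides
of the equivalence turn out to say that these do not depend on `k` for `q ≤ M`.

*Relative homology.* The relative boundaries over `k` are spanned by the integral ones, so they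
are the image in `kⁿ` of a subgroup `N ≤ ℤⁿ`. In characteristic zero their dimension is the rank
of `N`; over `ℤ/p` it is the rank of `N` exactly if `ℤⁿ/N` has no `p`-torsion
(`Submodule.finrank_spanCast_zmod_iff`). The torsion of `ℤⁿ/N` is that of `H_q(X_t, X_s; ℤ)`, as
chains modulo relative cycles are torsion-free. Hence `H_q(X_t, X_s; ℤ)` is free if and only if
`a_q(s, t; k)` is the same for `ℚ` and all `ℤ/p` (`CellComplex.free_relHomology_iff`).

*Persistent ranks.* The rank of `H_q(X_s; k) → H_q(X_t; k)` is
`a_q(s, t; k) - a_q(0, t; k) - dim ∂C_q(X_s; k)` (`CellComplex.finrank_range_homologyMap`), and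
`dim ∂C_q(X_s; k)` is `a_{q-1}(0, s; k)` for `q > 0` and zero for `q = 0`. Since `a_q(t, t; k)` is
the number of `q`-cells of `X_t`, induction on `q` recovers the `a_q` from these ranks
(`CellComplex.Filtration.finrank_range_homologyMap_eq_iff`).

*Diagrams.* The rank of `H_q(X_s; k) → H_q(X_t; k)` is the number of points `(b, d)` of the diagram
with `b ≤ s` and `t < d`, and inclusion–exclusion recovers the diagram from these numbers
(`PersistenceModule.IsDiagram.eq_of_finrank_eq`). A diagram exists over every field
(`CellComplex.Filtration.exists_isDiagram`): the cycles `Z_q(X_t)` and the boundaries `B_q(X_t)`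
form two chains of subspaces of one space, and two chains of subspaces have a common adapted basis
(`exists_basis_adapted`).
-/

/-! ### Subgroups of `ℤⁿ` and the subspaces they span over a field -/

namespace Submodule

/-- The subspace of `kⁿ` spanned by the images of the vectors of a subgroup `N` of `ℤⁿ`. -/
def spanCast {ι : Type*} (k : Type*) [Field k] (N : Submodule ℤ (ι → ℤ)) : Submodule k (ι → k) :=
  span k ((fun (v : ι → ℤ) i => (v i : k)) '' (N : Set (ι → ℤ)))

variable {ι : Type*} (N : Submodule ℤ (ι → ℤ))

theorem eq_sum_repr_smul {κ : Type*} [Fintype κ] (w : Module.Basis κ ℤ N) {v : ι → ℤ}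
    (hv : v ∈ N) : v = ∑ j, w.repr ⟨v, hv⟩ j • (w j : ι → ℤ) := by
  have h := congrArg N.subtype (w.sum_repr ⟨v, hv⟩)
  simp only [map_sum, map_smul, subtype_apply] at h
  exact h.symm

theorem spanCast_eq_span_range (k : Type*) [Field k] {κ : Type*} [Fintype κ]
    (w : Module.Basis κ ℤ N) :
    N.spanCast k = span k (Set.range fun j i => ((w j : ι → ℤ) i : k)) := by
  refine le_antisymm (span_le.2 ?_) (span_le.2 ?_)
  · rintro _ ⟨v, hv, rfl⟩
    have h : v = ∑ j, w.repr ⟨v, hv⟩ j • (w j : ι → ℤ) := eq_sum_repr_smul N w hv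
    have h' : (fun i => (v i : k)) =
        ∑ j, (w.repr ⟨v, hv⟩ j : k) • fun i => ((w j : ι → ℤ) i : k) := by
      funext i
      conv_lhs => rw [h]
      simp
    simp only [SetLike.mem_coe, h']
    exact sum_mem fun j _ => smul_mem _ _ (subset_span ⟨j, rfl⟩)
  · rintro _ ⟨j, rfl⟩
    exact subset_span ⟨w j, (w j).2, rfl⟩

theorem finrank_spanCast_eq_iff (k : Type*) [Field k] {κ : Type*} [Fintype κ]
    (w : Module.Basis κ ℤ N) :
    Module.finrank k (N.spanCast k) = Module.finrank ℤ N ↔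
      LinearIndependent k fun j i => ((w j : ι → ℤ) i : k) := by
  rw [linearIndependent_iff_card_eq_finrank_span, Set.finrank, ← spanCast_eq_span_range,
    Module.finrank_eq_card_basis w, eq_comm]

variable [Finite ι]

/-- Over a field of characteristic zero a subgroup of `ℤⁿ` spans a subspace of the same rank. -/
theorem finrank_spanCast_of_charZero (k : Type*) [Field k] [CharZero k] :
    Module.finrank k (N.spanCast k) = Module.finrank ℤ N := by
  have := Fintype.ofFinite ι
  have w := Module.finBasis ℤ N
  rw [finrank_spanCast_eq_iff N k w]
  have hZ : LinearIndependent ℤ fun j => (w j : ι → ℤ) :=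
    w.linearIndependent.map' N.subtype N.ker_subtype
  have hQ : LinearIndependent ℚ fun j i => ((w j : ι → ℤ) i : ℚ) := by
    rw [← LinearIndependent.iff_fractionRing ℤ ℚ]
    refine hZ.map' (LinearMap.compLeft (Algebra.linearMap ℤ ℚ) ι) ?_
    rw [LinearMap.ker_eq_bot]
    intro x y hxy
    funext i
    simpa using congrFun hxy i
  -- A rational left inverse `g` of the matrix of the `w j` is also a left inverse over `k`.
  classical
  obtain ⟨g, hg⟩ := LinearMap.exists_leftInverse_of_injective _
    (LinearMap.ker_eq_bot.2 hQ.fintypeLinearCombination_injective)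
  have hgw (j j') : ∑ i, ((w j : ι → ℤ) i : ℚ) * g (fun a => if i = a then 1 else 0) j' =
      if j = j' then 1 else 0 := by
    have h1 := congrFun (LinearMap.congr_fun hg (Pi.single j 1)) j'
    simp only [LinearMap.comp_apply, Fintype.linearCombination_apply_single, one_smul,
      LinearMap.id_apply] at h1
    rw [LinearMap.pi_apply_eq_sum_univ g] at h1
    simp only [Finset.sum_apply, Pi.smul_apply, smul_eq_mul] at h1
    rw [h1, Pi.single_apply]
    simp only [eq_comm]
  rw [Fintype.linearIndependent_iff]
  intro c hc j
  have h2 : ∑ i, (∑ j', c j' * ((w j' : ι → ℤ) i : k)) * (g (fun a => if i = a then 1 else 0) j : k) = 0 := by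
    refine Finset.sum_eq_zero fun i _ => ?_
    have := congrFun hc i
    simp only [Finset.sum_apply, Pi.smul_apply, smul_eq_mul, Pi.zero_apply] at this
    rw [this, zero_mul]
  simp only [Finset.sum_mul] at h2
  rw [Finset.sum_comm] at h2
  have h3 (j') : ∑ i, c j' * ((w j' : ι → ℤ) i : k) * (g (fun a => if i = a then 1 else 0) j : k) =
      if j' = j then c j else 0 := by
    have := congrArg (Rat.cast (K := k)) (hgw j' j)
    push_cast at this
    simp only [mul_assoc, ← Finset.mul_sum, this]
    split_ifs with h <;> simp [h]
  simpa [h3] using h2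

/-- Modulo a prime `p` the rank of a subgroup `N` of `ℤⁿ` is preserved exactly if `ℤⁿ/N` has no
`p`-torsion: both say that a combination of basis vectors of `N` is divisible by `p` in `ℤⁿ` only
if its coefficients are. -/
theorem finrank_spanCast_zmod_iff (p : ℕ) [Fact p.Prime] :
    Module.finrank (ZMod p) (N.spanCast (ZMod p)) = Module.finrank ℤ N ↔
      ∀ v, (p : ℤ) • v ∈ N → v ∈ N := by
  have hp : (p : ℤ) ≠ 0 := by exact_mod_cast (Fact.out : p.Prime).ne_zero
  have w := Module.finBasis ℤ N
  rw [finrank_spanCast_eq_iff N _ w, Fintype.linearIndependent_iff]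
  constructor
  · intro h v hv
    have hsum : (p : ℤ) • v = ∑ j, w.repr ⟨_, hv⟩ j • (w j : ι → ℤ) := eq_sum_repr_smul N w hv
    have h0 := h (fun j => (w.repr ⟨_, hv⟩ j : ZMod p)) (by
      funext i
      have := congrArg (Int.cast (R := ZMod p)) (congrFun hsum i)
      simpa using this.symm)
    choose d hd using fun j => (ZMod.intCast_zmod_eq_zero_iff_dvd _ p).1 (h0 j)
    have hvd : v = ∑ j, d j • (w j : ι → ℤ) := by
      refine smul_right_injective _ hp ?_
      simp only [Finset.smul_sum, smul_smul, ← hd]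
      exact hsum
    rw [hvd]
    exact sum_mem fun j _ => smul_mem _ _ (w j).2
  · intro h c hc j
    choose c' hc' using fun j => ZMod.intCast_surjective (c j)
    have hdvd (i) : (p : ℤ) ∣ (∑ j, c' j • (w j : ι → ℤ)) i := by
      rw [← ZMod.intCast_zmod_eq_zero_iff_dvd]
      have := congrFun hc i
      simp only [Finset.sum_apply, Pi.smul_apply, smul_eq_mul, Pi.zero_apply, ← hc'] at this
      simpa only [Finset.sum_apply, Pi.smul_apply, smul_eq_mul, Int.cast_sum,
        Int.cast_mul] using this
    choose v hv using hdvd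
    have hvN : v ∈ N := by
      refine h v ?_
      have : (p : ℤ) • v = ∑ j, c' j • (w j : ι → ℤ) := funext fun i => (hv i).symm
      rw [this]
      exact sum_mem fun j _ => smul_mem _ _ (w j).2
    have h1 : ∑ j, c' j • w j = (p : ℤ) • ⟨v, hvN⟩ := by
      refine Subtype.ext ?_
      have h2 : ∑ j, c' j • (w j : ι → ℤ) = (p : ℤ) • v := funext hv
      simpa only [AddSubmonoidClass.coe_finsetSum, coe_smul] using h2
    have h2 := congrArg (fun x => w.repr x j) h1
    simp only [map_smul, Finsupp.smul_apply, w.repr_sum_self] at h2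
    rw [← hc', h2]
    simp

/-- If `ℤⁿ/Z` is torsion-free, then `Z/N` is free exactly if `ℤⁿ/N` has no `p`-torsion for any
prime `p`. -/
theorem free_quotient_submoduleOf_iff {N Z : Submodule ℤ (ι → ℤ)} (hNZ : N ≤ Z)
    (hZ : ∀ (n : ℤ) v, n ≠ 0 → n • v ∈ Z → v ∈ Z) :
    Module.Free ℤ (Z ⧸ N.submoduleOf Z) ↔
      ∀ (p : ℕ) [Fact p.Prime], ∀ v, (p : ℤ) • v ∈ N → v ∈ N := by
  rw [Module.free_iff_isTorsionFree, Module.isTorsionFree_iff_smul_eq_zero]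
  constructor
  · intro h p hp v hv
    have hp0 : (p : ℤ) ≠ 0 := by exact_mod_cast hp.out.ne_zero
    have hvZ := hZ _ _ hp0 (hNZ hv)
    have h1 : (p : ℤ) • (Quotient.mk ⟨v, hvZ⟩ : Z ⧸ N.submoduleOf Z) = 0 := by
      rw [← Quotient.mk_smul, Quotient.mk_eq_zero]
      exact hv
    have h2 := (h _ _ h1).resolve_left hp0
    rw [Quotient.mk_eq_zero] at h2
    exact h2
  · intro h
    have key (n : ℕ) (hn : n ≠ 0) : ∀ v, (n : ℤ) • v ∈ N → v ∈ N := by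
      induction n using induction_on_primes with
      | zero => exact absurd rfl hn
      | one => simp
      | prime_mul p a hp ih =>
        intro v hv
        have := Fact.mk hp
        refine ih (right_ne_zero_of_mul hn) v (h p _ ?_)
        rwa [smul_smul, ← Nat.cast_mul]
    intro n x hx
    refine or_iff_not_imp_left.2 fun hn => ?_
    obtain ⟨z, rfl⟩ := Quotient.mk_surjective _ x
    rw [← Quotient.mk_smul, Quotient.mk_eq_zero] at hx
    rw [Quotient.mk_eq_zero]
    refine key n.natAbs (Int.natAbs_ne_zero.2 hn) z ?_
    have hx' : n • (z : ι → ℤ) ∈ N := hx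
    rcases Int.natAbs_eq n with h' | h'
    · rwa [h'] at hx'
    · rw [h', neg_smul, neg_mem_iff] at hx'
      exact hx'

end Submodule

/-! ### Ranks of chain groups, boundaries and homology maps -/

/-- The space of functions vanishing off `S` has dimension `|S|`. -/
theorem finrank_eq_ncard_of_mem_iff {ι k : Type*} [Fintype ι] [Field k] (S : Set ι)
    (W : Submodule k (ι → k)) (hW : ∀ c, c ∈ W ↔ ∀ i ∉ S, c i = 0) :
    Module.finrank k W = S.ncard := by
  classical
  let e : W ≃ₗ[k] (S → k) :=
    { toFun := fun c i => c.1 i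
      map_add' := fun _ _ => rfl
      map_smul' := fun _ _ => rfl
      invFun := fun f => ⟨fun i => if h : i ∈ S then f ⟨i, h⟩ else 0,
        (hW _).2 fun i hi => dif_neg hi⟩
      left_inv := fun c => by
        ext i
        by_cases hi : i ∈ S
        · simp [hi]
        · simp [hi, (hW _).1 c.2 i hi]
      right_inv := fun f => by
        ext i
        simp }
  rw [e.finrank_eq, Module.finrank_fintype_fun_eq_card, ← Nat.card_eq_fintype_card,
    Nat.card_coe_set_eq]

theorem finrank_submoduleOf {k E : Type*} [Field k] [AddCommGroup E] [Module k E]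
    (N Z : Submodule k E) :
    Module.finrank k (N.submoduleOf Z) = Module.finrank k (Z ⊓ N : Submodule k E) := by
  rw [← Submodule.map_comap_subtype]
  exact (Submodule.equivMapOfInjective _ (Submodule.injective_subtype _) _).finrank_eq

namespace CellComplex

variable {X : CellComplex.{u}}

section Ring

variable (R : Type v) [CommRing R]

theorem boundary_apply (c : X.cell → R) (τ : X.cell) :
    X.boundary R c τ = ∑ σ, (X.incidence σ τ : R) * c σ := rfl

theorem boundary_boundary (c : X.cell → R) : X.boundary R (X.boundary R c) = 0 := by
  funext ρ
  simp only [boundary_apply, Finset.mul_sum, Pi.zero_apply]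
  rw [Finset.sum_comm]
  refine Finset.sum_eq_zero fun σ _ => ?_
  have h := congrArg (Int.cast (R := R)) (X.sum_incidence_mul_incidence σ ρ)
  push_cast at h
  rw [← zero_mul (c σ), ← h, Finset.sum_mul]
  exact Finset.sum_congr rfl fun τ _ => by ring

theorem boundary_mem_chains {B : Set X.cell} (hB : X.IsSubcomplex B) {q : ℕ} {c : X.cell → R}
    (hc : c ∈ X.chains R B (q + 1)) : X.boundary R c ∈ X.chains R B q := by
  intro τ hτ
  rw [boundary_apply]
  refine Finset.sum_eq_zero fun σ _ => ?_
  by_cases hi : X.incidence σ τ = 0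
  · simp [hi]
  · rw [hc σ, mul_zero]
    rintro ⟨hσ, hd⟩
    have := X.dim_eq_of_incidence_ne_zero σ τ hi
    exact hτ ⟨hB σ hσ τ hi, by omega⟩

theorem boundary_mem_chainsOn {A : Set X.cell} (hA : X.IsSubcomplex A) {q : ℕ} {c : X.cell → R}
    (hc : c ∈ X.chains R A q) : X.boundary R c ∈ X.chainsOn R A := by
  intro τ hτ
  rw [boundary_apply]
  refine Finset.sum_eq_zero fun σ _ => ?_
  by_cases hi : X.incidence σ τ = 0
  · simp [hi]
  · rw [hc σ fun h => hτ (hA σ h.1 τ hi), mul_zero]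

theorem boundary_eq_zero_of_mem_chains_zero {A : Set X.cell} {c : X.cell → R}
    (hc : c ∈ X.chains R A 0) : X.boundary R c = 0 := by
  funext τ
  rw [boundary_apply]
  refine Finset.sum_eq_zero fun σ _ => ?_
  by_cases hi : X.incidence σ τ = 0
  · simp [hi]
  · rw [hc σ, mul_zero]
    rintro ⟨-, hd⟩
    have hd : X.dim σ = 0 := hd
    have := X.dim_eq_of_incidence_ne_zero σ τ hi
    omega

theorem map_boundary_chains_zero (A : Set X.cell) :
    (X.chains R A 0).map (X.boundary R) = ⊥ := by
  rw [eq_bot_iff]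
  rintro _ ⟨c, hc, rfl⟩
  exact (Submodule.mem_bot R).2 (boundary_eq_zero_of_mem_chains_zero R hc)

theorem relBoundaries_le_relCycles {A B : Set X.cell} (hA : X.IsSubcomplex A)
    (hB : X.IsSubcomplex B) (h : A ⊆ B) (q : ℕ) :
    X.relBoundaries R B A q ≤ X.relCycles R B A q := by
  refine sup_le ?_ ?_
  · rintro _ ⟨c, hc, rfl⟩
    refine ⟨boundary_mem_chains R hB hc, ?_⟩
    rw [SetLike.mem_coe, Submodule.mem_comap, boundary_boundary]
    exact zero_mem _
  · exact fun c hc => ⟨chains_mono R h q hc, boundary_mem_chainsOn R hA hc⟩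

theorem chainsOn_empty : X.chainsOn R ∅ = ⊥ :=
  eq_bot_iff.2 fun _ hc => (Submodule.mem_bot R).2 (funext fun σ => hc σ (Set.notMem_empty σ))

theorem chains_empty (q : ℕ) : X.chains R ∅ q = ⊥ := by
  simp [chains, chainsOn_empty]

theorem relBoundaries_empty (B : Set X.cell) (q : ℕ) :
    X.relBoundaries R B ∅ q = (X.chains R B (q + 1)).map (X.boundary R) := by
  rw [relBoundaries, chains_empty, sup_bot_eq]

theorem relCycles_empty (A : Set X.cell) (q : ℕ) :
    X.relCycles R A ∅ q = X.chains R A q ⊓ LinearMap.ker (X.boundary R) := by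
  rw [relCycles, chainsOn_empty, LinearMap.ker]

end Ring

/-- The quotient of all integral chains by the relative cycles is torsion-free. -/
theorem mem_relCycles_of_smul_mem {A B : Set X.cell} {q : ℕ} {n : ℤ} {c : X.cell → ℤ}
    (hn : n ≠ 0) (hc : n • c ∈ X.relCycles ℤ B A q) : c ∈ X.relCycles ℤ B A q := by
  refine ⟨fun σ hσ => ?_, fun σ hσ => ?_⟩
  · have := hc.1 σ hσ
    simpa [hn] using this
  · have := hc.2 σ hσ
    rw [map_smul] at this
    simpa [hn] using this

section Field

variable (k : Type v) [Field k]

theorem intCast_boundary (c : X.cell → ℤ) :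
    (fun τ => (X.boundary ℤ c τ : k)) = X.boundary k fun σ => (c σ : k) := by
  funext τ
  simp [boundary_apply]

/-- The relative boundaries over a field are spanned by the integral ones. -/
theorem relBoundaries_eq_spanCast (A B : Set X.cell) (q : ℕ) :
    X.relBoundaries k B A q = (X.relBoundaries ℤ B A q).spanCast k := by
  classical
  refine le_antisymm (sup_le ?_ ?_) (Submodule.span_le.2 ?_)
  · rintro _ ⟨c, hc, rfl⟩
    rw [LinearMap.pi_apply_eq_sum_univ (X.boundary k) c]
    refine sum_mem fun σ _ => ?_
    by_cases hσ : σ ∈ B ∧ X.dim σ = q + 1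
    · refine Submodule.smul_mem _ _ (Submodule.subset_span
        ⟨X.boundary ℤ fun τ => if σ = τ then 1 else 0, Submodule.mem_sup_left
          ⟨_, fun τ hτ => if_neg ?_, rfl⟩, ?_⟩)
      · rintro rfl
        exact hτ hσ
      · simp only [intCast_boundary, Int.cast_ite, Int.cast_one, Int.cast_zero]
    · rw [hc σ hσ, zero_smul]
      exact zero_mem _
  · intro c hc
    rw [pi_eq_sum_univ c]
    refine sum_mem fun σ _ => ?_
    by_cases hσ : σ ∈ A ∧ X.dim σ = q
    · refine Submodule.smul_mem _ _ (Submodule.subset_span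
        ⟨fun τ => if σ = τ then 1 else 0, Submodule.mem_sup_right fun τ hτ => if_neg ?_, ?_⟩)
      · rintro rfl
        exact hτ hσ
      · simp only [Int.cast_ite, Int.cast_one, Int.cast_zero]
    · rw [hc σ hσ, zero_smul]
      exact zero_mem _
  · rintro _ ⟨v, hv, rfl⟩
    obtain ⟨_, ⟨c, hc, rfl⟩, a, ha, rfl⟩ := Submodule.mem_sup.1 hv
    have h : (fun i => ((X.boundary ℤ c + a) i : k)) =
        X.boundary k (fun σ => (c σ : k)) + fun σ => (a σ : k) := by
      rw [← intCast_boundary]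
      funext i
      simp
    simp only [SetLike.mem_coe, h]
    refine Submodule.add_mem_sup ⟨_, fun σ hσ => ?_, rfl⟩ fun σ hσ => ?_
    · simp [hc σ hσ]
    · simp [ha σ hσ]

theorem finrank_chains (A : Set X.cell) (q : ℕ) :
    Module.finrank k (X.chains k A q) = {σ | σ ∈ A ∧ X.dim σ = q}.ncard :=
  finrank_eq_ncard_of_mem_iff _ _ fun _ => Iff.rfl

theorem finrank_relBoundaries_self {A : Set X.cell} (hA : X.IsSubcomplex A) (q : ℕ) :
    Module.finrank k (X.relBoundaries k A A q) = {σ | σ ∈ A ∧ X.dim σ = q}.ncard := by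
  have h : X.relBoundaries k A A q = X.chains k A q := by
    refine sup_eq_right.2 ?_
    rintro _ ⟨c, hc, rfl⟩
    exact boundary_mem_chains k hA hc
  rw [h, finrank_chains k]

theorem finrank_relCycles_empty (A : Set X.cell) (q : ℕ) :
    Module.finrank k (X.relCycles k A ∅ q) +
        Module.finrank k ((X.chains k A q).map (X.boundary k)) =
      Module.finrank k (X.chains k A q) := by
  rw [relCycles_empty, ← LinearMap.finrank_range_add_finrank_ker
    ((X.boundary k).domRestrict (X.chains k A q)), add_comm, LinearMap.range_domRestrict,
    LinearMap.ker_domRestrict]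
  congr 1
  exact (finrank_submoduleOf _ _).symm

/-- The rank of `H_q(A; k) → H_q(B; k)` in terms of ranks of boundaries: its image is
`Z_q(A) / (Z_q(A) ∩ ∂C_{q+1}(B))`, and `∂C_{q+1}(B)` meets `Z_q(A)` and `C_q(A)` in the same
subspace. -/
theorem finrank_range_homologyMap {A B : Set X.cell} (h : A ⊆ B) (q : ℕ) :
    Module.finrank k (LinearMap.range (homologyMap k h q)) +
        Module.finrank k (X.relBoundaries k B ∅ q) +
        Module.finrank k ((X.chains k A q).map (X.boundary k)) =
      Module.finrank k (X.relBoundaries k B A q) := by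
  have h1 : LinearMap.range (homologyMap k h q) =
      LinearMap.range ((homologyMap k h q).comp (Submodule.mkQ _)) :=
    (LinearMap.range_comp_of_range_eq_top _ (Submodule.range_mkQ _)).symm
  have h2 := LinearMap.finrank_range_add_finrank_ker
    ((homologyMap k h q).comp (Submodule.mkQ
      ((X.relBoundaries k A ∅ q).submoduleOf (X.relCycles k A ∅ q))))
  have h3 : LinearMap.ker ((homologyMap k h q).comp (Submodule.mkQ
      ((X.relBoundaries k A ∅ q).submoduleOf (X.relCycles k A ∅ q)))) =
      (X.relBoundaries k B ∅ q).submoduleOf (X.relCycles k A ∅ q) := by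
    ext z
    exact Submodule.Quotient.mk_eq_zero _
  have h4 : Module.finrank k ((X.relBoundaries k B ∅ q).submoduleOf (X.relCycles k A ∅ q)) =
      Module.finrank k (X.relBoundaries k B ∅ q ⊓ X.chains k A q : Submodule k (X.cell → k)) := by
    have h5 : X.relBoundaries k B ∅ q ⊓ X.chains k A q =
        X.relBoundaries k B ∅ q ⊓ X.relCycles k A ∅ q := by
      rw [relCycles_empty]
      refine le_antisymm (le_inf inf_le_left (le_inf inf_le_right ?_))
        (inf_le_inf_left _ inf_le_left)
      rintro _ ⟨hc, -⟩
      rw [relBoundaries_empty] at hc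
      obtain ⟨c, -, rfl⟩ := hc
      exact boundary_boundary k c
    rw [h5, inf_comm, finrank_submoduleOf]
  have h5 := Submodule.finrank_sup_add_finrank_inf_eq (X.relBoundaries k B ∅ q) (X.chains k A q)
  have h6 : X.relBoundaries k B ∅ q ⊔ X.chains k A q = X.relBoundaries k B A q := by
    rw [relBoundaries_empty, relBoundaries]
  have h7 := finrank_relCycles_empty k A q
  rw [h3, ← h1, h4] at h2
  rw [h6] at h5
  omega

end Field

end CellComplex

/-! ### Persistence diagrams are determined by ranks -/

namespace PersistenceModule

section Rank

variable {k : Type v} [Field k] {T : Type w} [LinearOrder T]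

theorem Iso.finrank_range_map {V : PersistenceModule.{u, v, w} k T}
    {W : PersistenceModule.{v, v, w} k T} (e : Iso V W) {s t : T} (hst : s ≤ t) :
    Module.finrank k (LinearMap.range (V.map hst)) =
      Module.finrank k (LinearMap.range (W.map hst)) := by
  have h : (e.equiv t).toLinearMap.comp (V.map hst) =
      (W.map hst).comp (e.equiv s).toLinearMap := LinearMap.ext fun x => e.comm hst x
  rw [← LinearMap.range_comp_of_range_eq_top (W.map hst) (e.equiv s).range, ← h,
    LinearMap.range_comp]
  exact (LinearEquiv.finrank_map_eq (e.equiv t) _).symm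

theorem finrank_range_directSum_interval_map {L : ℕ} (b : Fin L → T) (d : Fin L → WithTop T)
    {s t : T} (hst : s ≤ t) :
    Module.finrank k (LinearMap.range ((directSum fun i => interval k (b i) (d i)).map hst)) =
      {i | b i ≤ s ∧ (t : WithTop T) < d i}.ncard := by
  classical
  let φ : (⨁ i, intervalSpace k (b i) (d i) s) →ₗ[k] ⨁ i, intervalSpace k (b i) (d i) t :=
    DirectSum.lmap fun i => intervalMap k (b i) (d i) hst
  change Module.finrank k (LinearMap.range φ) = _
  let J : (⨁ i, intervalSpace k (b i) (d i) t) →ₗ[k] (Fin L → k) :=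
    LinearMap.pi fun i => (intervalSpace k (b i) (d i) t).subtype.comp
      (DirectSum.component k _ _ i)
  have hJ : Function.Injective J := by
    intro x y hxy
    refine DFinsupp.ext fun i => Subtype.ext ?_
    exact congrFun hxy i
  rw [← finrank_eq_ncard_of_mem_iff (k := k) {i | b i ≤ s ∧ (t : WithTop T) < d i}
    ((LinearMap.range φ).map J) ?_]
  · exact (Submodule.equivMapOfInjective J hJ _).finrank_eq
  · intro c
    constructor
    · rintro ⟨_, ⟨x, rfl⟩, rfl⟩ i hi
      change ((intervalMap k (b i) (d i) hst (x i) : intervalSpace k (b i) (d i) t) : k) = 0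
      have h0 : intervalMap k (b i) (d i) hst = 0 := dif_neg hi
      rw [h0]
      rfl
    · intro hc
      have hmem (i) : c i ∈ intervalSpace k (b i) (d i) s := by
        by_cases hi : i ∈ {i | b i ≤ s ∧ (t : WithTop T) < d i}
        · have : intervalSpace k (b i) (d i) s = ⊤ :=
            if_pos ⟨hi.1, lt_of_le_of_lt (WithTop.coe_le_coe.2 hst) hi.2⟩
          rw [this]
          exact Submodule.mem_top
        · rw [hc i hi]
          exact zero_mem _
      refine ⟨_, ⟨(DirectSum.linearEquivFunOnFintype k (Fin L)
        (fun i => intervalSpace k (b i) (d i) s)).symm fun i => ⟨c i, hmem i⟩, rfl⟩, ?_⟩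
      funext i
      change ((intervalMap k (b i) (d i) hst ⟨c i, hmem i⟩ :
        intervalSpace k (b i) (d i) t) : k) = c i
      by_cases hi : b i ≤ s ∧ (t : WithTop T) < d i
      · rw [intervalMap, dif_pos hi]
        rfl
      · rw [intervalMap, dif_neg hi]
        exact (hc i hi).symm

/-- The rank of `V_s → V_t` is the number of points of the diagram that are born at time `s` or
earlier and die after time `t`. -/
theorem IsDiagram.finrank_range_map [OrderBot T] {V : PersistenceModule.{u, v, w} k T}
    {D : Multiset (T × WithTop T)} (h : V.IsDiagram D) {s t : T} (hst : s ≤ t) :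
    Module.finrank k (LinearMap.range (V.map hst)) =
      D.countP fun x => x.1 ≤ s ∧ (t : WithTop T) < x.2 := by
  obtain ⟨L, b, d, -, rfl, ⟨e⟩⟩ := h
  rw [e.finrank_range_map, finrank_range_directSum_interval_map, Multiset.countP_map,
    Set.ncard_eq_toFinset_card']
  simp [Finset.card, Finset.filter]

end Rank

end PersistenceModule

section Multiset

variable {T : Type w} [LinearOrder T]

/-- Inclusion–exclusion for the multiplicity of a point `(b, d)`, where `s` and `t` are so close
to `b` and `d` from the left that no point has its first coordinate in `(s, b)` or its second
coordinate in `(t, d)`. -/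
theorem Multiset.countP_add_countP_eq_count_add {b s t : T} {d : WithTop T} (hsb : s < b)
    (htd : (t : WithTop T) < d) (D : Multiset (T × WithTop T))
    (hb : ∀ x ∈ D, x.1 < b → x.1 ≤ s) (hd : ∀ x ∈ D, x.2 < d → x.2 ≤ t) :
    (D.countP fun x => x.1 ≤ b ∧ (t : WithTop T) < x.2) + (D.countP fun x => x.1 ≤ s ∧ d < x.2) =
      D.count (b, d) + (D.countP fun x => x.1 ≤ s ∧ (t : WithTop T) < x.2) +
        D.countP fun x => x.1 ≤ b ∧ d < x.2 := by
  induction D using Multiset.induction with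
  | empty => simp
  | cons x D ih =>
    have ih := ih (fun y hy => hb y (Multiset.mem_cons_of_mem hy))
      fun y hy => hd y (Multiset.mem_cons_of_mem hy)
    have h1 := hb x (Multiset.mem_cons_self x D)
    have h2 := hd x (Multiset.mem_cons_self x D)
    have h3 : (b, d) = x ↔ (x.1 ≤ b ∧ ¬ x.1 ≤ s) ∧ ((t : WithTop T) < x.2 ∧ ¬ d < x.2) := by
      constructor
      · rintro rfl
        exact ⟨⟨le_rfl, hsb.not_ge⟩, htd, lt_irrefl _⟩
      · rintro ⟨⟨h4, h5⟩, h6, h7⟩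
        refine Prod.ext ?_ ?_
        · exact le_antisymm (not_lt.1 fun h => h5 (h1 h)) h4
        · exact le_antisymm (not_lt.1 fun h => h6.not_ge (h2 h)) (not_lt.1 h7)
    have h4 : x.1 ≤ s → x.1 ≤ b := fun h => h.trans hsb.le
    have h5 : d < x.2 → (t : WithTop T) < x.2 := htd.trans
    simp only [Multiset.countP_cons, Multiset.count_cons, h3]
    clear h1 h2 h3 hb hd
    grind

theorem Multiset.eq_of_countP_eq [OrderBot T] {D D' : Multiset (T × WithTop T)}
    (hD : ∀ x ∈ D, ⊥ < x.1 ∧ (x.1 : WithTop T) < x.2)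
    (hD' : ∀ x ∈ D', ⊥ < x.1 ∧ (x.1 : WithTop T) < x.2)
    (h : ∀ s t : T, s ≤ t → (D.countP fun x => x.1 ≤ s ∧ (t : WithTop T) < x.2) =
      D'.countP fun x => x.1 ≤ s ∧ (t : WithTop T) < x.2) : D = D' := by
  ext ⟨b, d⟩
  by_cases hbd : ⊥ < b ∧ (b : WithTop T) < d
  swap
  · rw [Multiset.count_eq_zero.2 fun hx => hbd (hD _ hx),
      Multiset.count_eq_zero.2 fun hx => hbd (hD' _ hx)]
  obtain ⟨s, hsb, hs⟩ : ∃ s < b, ∀ x ∈ D + D', x.1 < b → x.1 ≤ s := by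
    let S := insert ⊥ (((D + D').map Prod.fst).toFinset.filter fun y => y < b)
    have hS : S.Nonempty := Finset.insert_nonempty _ _
    refine ⟨S.max' hS, (Finset.max'_lt_iff _ _).2 fun y hy => ?_, fun x hx hxb =>
      Finset.le_max' S x.1 (Finset.mem_insert_of_mem (Finset.mem_filter.2 ⟨?_, hxb⟩))⟩
    · rcases Finset.mem_insert.1 hy with rfl | hy
      · exact hbd.1
      · exact (Finset.mem_filter.1 hy).2
    · exact Multiset.mem_toFinset.2 (Multiset.mem_map_of_mem _ hx)
  obtain ⟨t, hbt, htd, ht⟩ : ∃ t : T, b ≤ t ∧ (t : WithTop T) < d ∧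
      ∀ x ∈ D + D', x.2 < d → x.2 ≤ t := by
    let S := insert (b : WithTop T) (((D + D').map Prod.snd).toFinset.filter fun y => y < d)
    have hS : S.Nonempty := Finset.insert_nonempty _ _
    have hlt : S.max' hS < d := (Finset.max'_lt_iff _ _).2 fun y hy => by
      rcases Finset.mem_insert.1 hy with rfl | hy
      · exact hbd.2
      · exact (Finset.mem_filter.1 hy).2
    obtain ⟨t, ht⟩ := WithTop.ne_top_iff_exists.1 hlt.ne_top
    refine ⟨t, ?_, ?_, fun x hx hxd => ?_⟩
    · rw [← WithTop.coe_le_coe, ht]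
      exact Finset.le_max' S _ (Finset.mem_insert_self _ _)
    · rwa [ht]
    · rw [ht]
      exact Finset.le_max' S x.2 (Finset.mem_insert_of_mem (Finset.mem_filter.2
        ⟨Multiset.mem_toFinset.2 (Multiset.mem_map_of_mem _ hx), hxd⟩))
  have key (r : T) (hr : r ≤ b) : (D.countP fun x => x.1 ≤ r ∧ d < x.2) =
      D'.countP fun x => x.1 ≤ r ∧ d < x.2 := by
    induction d with
    | top => simp
    | coe d => exact h r d (hr.trans (WithTop.coe_le_coe.1 hbd.2.le))
  have e1 := D.countP_add_countP_eq_count_add hsb htd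
    (fun x hx => hs x (Multiset.mem_add.2 (Or.inl hx)))
    (fun x hx => ht x (Multiset.mem_add.2 (Or.inl hx)))
  have e2 := D'.countP_add_countP_eq_count_add hsb htd
    (fun x hx => hs x (Multiset.mem_add.2 (Or.inr hx)))
    (fun x hx => ht x (Multiset.mem_add.2 (Or.inr hx)))
  have e3 := h b t hbt
  have e4 := h s t (hsb.le.trans hbt)
  have e5 := key s hsb.le
  have e6 := key b le_rfl
  omega

end Multiset

namespace PersistenceModule

/-- Persistence modules over possibly different fields whose structure maps have the same ranks
have the same diagrams. -/
theorem IsDiagram.eq_of_finrank_eq {k : Type*} [Field k] {k' : Type*} [Field k'] {T : Type w}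
    [LinearOrder T] [OrderBot T] {V : PersistenceModule k T} {V' : PersistenceModule k' T}
    {D D' : Multiset (T × WithTop T)} (hV : V.IsDiagram D) (hV' : V'.IsDiagram D')
    (h : ∀ (s t : T) (hst : s ≤ t), Module.finrank k (LinearMap.range (V.map hst)) =
      Module.finrank k' (LinearMap.range (V'.map hst))) : D = D' := by
  refine Multiset.eq_of_countP_eq ?_ ?_ fun s t hst => ?_
  · obtain ⟨L, b, d, hbd, rfl, -⟩ := hV
    simpa using hbd
  · obtain ⟨L, b, d, hbd, rfl, -⟩ := hV'
    simpa using hbd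
  · rw [← hV.finrank_range_map hst, ← hV'.finrank_range_map hst, h s t hst]

end PersistenceModule

/-! ### Bases adapted to two chains of subspaces -/

section Chains

variable {k E : Type*} [Field k] [AddCommGroup E] [Module k E] [FiniteDimensional k E]

/-- Two chains `𝒜`, `ℬ` of subspaces have a common adapted basis in each subspace `W`. To pass
from a hyperplane `H` of `W` to `W`, one chooses `H` so that it contains the proper traces of `𝒜`
on `W`; then the new basis vector may be taken in the smallest member of `ℬ` whose trace is not
contained in `H`. -/
theorem exists_linearIndepOn_adapted {𝒜 ℬ : Set (Submodule k E)} (h𝒜 : IsChain (· ≤ ·) 𝒜)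
    (hℬ : IsChain (· ≤ ·) ℬ) (W : Submodule k E) :
    ∃ s : Set E, LinearIndepOn k id s ∧ Submodule.span k s = W ∧
      ∀ A ∈ 𝒜 ∪ ℬ, A ⊓ W ≤ Submodule.span k (s ∩ A) := by
  induction W using WellFoundedLT.induction with
  | ind W ih =>
  rcases eq_or_ne W ⊥ with rfl | hW
  · exact ⟨∅, linearIndepOn_empty k _, Submodule.span_empty, by simp⟩
  obtain ⟨H, hHW, hH⟩ : ∃ H, H ⋖ W ∧ ∀ A ∈ 𝒜, A ⊓ W ≤ H ∨ W ≤ A := by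
    let 𝒢 : Set (Submodule k E) := {G | G < W ∧ (G = ⊥ ∨ ∃ A ∈ 𝒜, G = A ⊓ W)}
    obtain ⟨G, hG, hmax⟩ := wellFounded_gt.has_min 𝒢 ⟨⊥, bot_lt_iff_ne_bot.2 hW, Or.inl rfl⟩
    obtain ⟨H, hGH, hHW⟩ := exists_le_covBy_of_lt hG.1
    refine ⟨H, hHW, fun A hA => or_iff_not_imp_right.2 fun hWA => le_trans ?_ hGH⟩
    have hlt : A ⊓ W < W := inf_le_right.lt_of_ne fun h => hWA (inf_eq_right.1 h)
    have hle : A ⊓ W ≤ G ∨ G ≤ A ⊓ W := by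
      rcases hG.2 with rfl | ⟨A', hA', rfl⟩
      · exact Or.inr bot_le
      · exact (h𝒜.total hA hA').imp (inf_le_inf_right W) (inf_le_inf_right W)
    rcases hle with h | h
    · exact h
    · exact (h.eq_of_not_lt (hmax _ ⟨hlt, Or.inr ⟨A, hA, rfl⟩⟩)).ge
  obtain ⟨v, hvW, hvH, hv⟩ : ∃ v ∈ W, v ∉ H ∧ ∀ B ∈ ℬ, B ⊓ W ≤ H ∨ v ∈ B := by
    by_cases hex : ∃ B ∈ ℬ, ¬ B ⊓ W ≤ H
    · obtain ⟨B, ⟨hB, hBH⟩, hmin⟩ := wellFounded_lt.has_min {B | B ∈ ℬ ∧ ¬ B ⊓ W ≤ H} hex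
      obtain ⟨v, hvB, hvH⟩ := SetLike.not_le_iff_exists.1 hBH
      refine ⟨v, hvB.2, hvH, fun B' hB' => or_iff_not_imp_left.2 fun hB'H => ?_⟩
      rcases hℬ.total hB hB' with h | h
      · exact h hvB.1
      · exact (h.eq_of_not_lt (hmin B' ⟨hB', hB'H⟩)).ge hvB.1
    · push Not at hex
      obtain ⟨v, hvW, hvH⟩ := SetLike.exists_of_lt hHW.lt
      exact ⟨v, hvW, hvH, fun B hB => Or.inl (hex B hB)⟩
  obtain ⟨s, hs, rfl, hsA⟩ := ih H hHW.lt
  have hW' : Submodule.span k {v} ⊔ Submodule.span k s = W := by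
    refine (hHW.eq_or_eq le_sup_right (sup_le ?_ hHW.le)).resolve_left fun h => hvH ?_
    · rwa [Submodule.span_singleton_le_iff_mem]
    · rw [← h]
      exact Submodule.mem_sup_left (Submodule.mem_span_singleton_self v)
  refine ⟨insert v s, hs.id_insert hvH, by rw [Submodule.span_insert, hW'], fun A hA => ?_⟩
  have hle : Submodule.span k (s ∩ A) ≤ Submodule.span k (insert v s ∩ A) :=
    Submodule.span_mono (Set.inter_subset_inter_left _ (Set.subset_insert v s))
  have hcases : A ⊓ W ≤ Submodule.span k s ∨ v ∈ A := by
    rcases hA with hA | hA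
    · exact (hH A hA).imp_right fun h => h hvW
    · exact hv A hA
  rcases hcases with h | hvA
  · exact (le_inf inf_le_left h).trans ((hsA A hA).trans hle)
  · rintro x ⟨hxA, hxW⟩
    rw [← hW'] at hxW
    obtain ⟨y, hy, z, hz, rfl⟩ := Submodule.mem_sup.1 hxW
    obtain ⟨c, rfl⟩ := Submodule.mem_span_singleton.1 hy
    have hzA : z ∈ A := (Submodule.add_mem_iff_right A (A.smul_mem c hvA)).1 hxA
    exact add_mem (Submodule.smul_mem _ _ (Submodule.subset_span ⟨Set.mem_insert v s, hvA⟩))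
      (hle (hsA A hA ⟨hzA, hz⟩))

theorem exists_basis_adapted {𝒜 ℬ : Set (Submodule k E)} (h𝒜 : IsChain (· ≤ ·) 𝒜)
    (hℬ : IsChain (· ≤ ·) ℬ) :
    ∃ (s : Set E) (e : Module.Basis s k E),
      ∀ A ∈ 𝒜 ∪ ℬ, ∀ z ∈ A, ∀ i, e.repr z i ≠ 0 → e i ∈ A := by
  obtain ⟨s, hs, hspan, hsA⟩ := exists_linearIndepOn_adapted h𝒜 hℬ ⊤
  let e : Module.Basis s k E := Module.Basis.mk (v := fun x : s => (x : E)) hs (by simp [hspan])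
  have he (i : s) : e i = i := Module.Basis.mk_apply _ _ i
  refine ⟨s, e, fun A hA z hz i hi => ?_⟩
  have himg : s ∩ A = e '' {i | e i ∈ A} := by
    ext x
    constructor
    · rintro ⟨hx, hxA⟩
      exact ⟨⟨x, hx⟩, by simpa [he] using hxA, he _⟩
    · rintro ⟨i, hi, rfl⟩
      exact ⟨by simp [he], hi⟩
  have hz' := hsA A hA ⟨hz, Submodule.mem_top⟩
  rw [himg, Module.Basis.mem_span_image] at hz'
  exact hz' (Finsupp.mem_support_iff.2 hi)

end Chains

/-! ### Interval decomposition of persistent homology -/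

namespace PersistenceModule

variable (k : Type v) [Field k] {T : Type w} [LinearOrder T]

open Classical in
/-- The projection of `k` onto the space of the interval module `I(b, d)` at time `t`. -/
noncomputable def intervalProj (b : T) (d : WithTop T) (t : T) : k →ₗ[k] intervalSpace k b d t :=
  if h : b ≤ t ∧ (t : WithTop T) < d then
    LinearMap.id.codRestrict _ fun x => by
      have ht : intervalSpace k b d t = ⊤ := if_pos h
      rw [ht]
      exact Submodule.mem_top
  else 0

variable {k} {b : T} {d : WithTop T} {s t : T}

theorem coe_intervalProj_of_mem (h : b ≤ t ∧ (t : WithTop T) < d) (x : k) :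
    (intervalProj k b d t x : k) = x := by
  rw [intervalProj, dif_pos h]
  rfl

theorem coe_intervalProj_of_notMem (h : ¬ (b ≤ t ∧ (t : WithTop T) < d)) (x : k) :
    (intervalProj k b d t x : k) = 0 := by
  rw [intervalProj, dif_neg h]
  rfl

theorem coe_eq_zero_of_notMem (h : ¬ (b ≤ t ∧ (t : WithTop T) < d))
    (x : intervalSpace k b d t) : (x : k) = 0 := by
  have hs : intervalSpace k b d t = ⊥ := if_neg h
  exact (Submodule.mem_bot k).1 (hs ▸ x.2)

theorem intervalMap_intervalProj (hst : s ≤ t) {x : k} (hx : ¬ b ≤ s → x = 0) :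
    intervalMap k b d hst (intervalProj k b d s x) = intervalProj k b d t x := by
  refine Subtype.ext ?_
  by_cases hb : b ≤ s
  · by_cases ht : (t : WithTop T) < d
    · rw [intervalMap, dif_pos ⟨hb, ht⟩, coe_intervalProj_of_mem ⟨hb.trans hst, ht⟩]
      exact coe_intervalProj_of_mem ⟨hb, (WithTop.coe_le_coe.2 hst).trans_lt ht⟩ x
    · rw [coe_intervalProj_of_notMem fun h => ht h.2, intervalMap, dif_neg fun h => ht h.2]
      rfl
  · simp [hx hb]

end PersistenceModule

namespace CellComplex.Filtration

variable {X : CellComplex.{u}} {T : Type w} [LinearOrder T] [OrderBot T] (F : X.Filtration T)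

/-- A property of subcomplexes that persists along the filtration holds from some time on: by
right-continuity, and since there are only finitely many cells, there is a first time. -/
theorem exists_forall_iff_le (P : Set X.cell → Prop)
    (hP : ∀ s t, s ≤ t → P (F.sub s) → P (F.sub t)) :
    ∃ b : WithTop T, ∀ t : T, P (F.sub t) ↔ b ≤ t := by
  classical
  by_cases hex : ∃ t, P (F.sub t)
  swap
  · push Not at hex
    exact ⟨⊤, fun t => by simp [hex t]⟩
  obtain ⟨t₀, ht₀⟩ := hex
  obtain ⟨S, ⟨t₁, rfl, ht₁⟩, hmin⟩ := wellFounded_lt.has_min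
    {S : Set X.cell | ∃ t, F.sub t = S ∧ P S} ⟨_, t₀, rfl, ht₀⟩
  have hsub (t) (ht : P (F.sub t)) : F.sub t₁ ⊆ F.sub t := by
    rcases le_total t₁ t with h | h
    · exact F.mono h
    · exact ((F.mono h).eq_of_not_lt (hmin _ ⟨t, rfl, ht⟩)).ge
  choose β hβ using F.exists_isLeast t₁
  -- The first time at which all cells of `X_{t₁}` are present.
  let b : T := Finset.univ.sup fun σ : F.sub t₁ => β σ σ.2
  have hle (t) (ht : F.sub t₁ ⊆ F.sub t) : b ≤ t :=
    Finset.sup_le fun σ _ => (hβ σ σ.2).2 (ht σ.2)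
  have hb : F.sub b = F.sub t₁ := by
    refine (F.mono (hle t₁ le_rfl)).antisymm fun σ hσ => ?_
    have hσb : β σ hσ ≤ b :=
      Finset.le_sup (f := fun σ : F.sub t₁ => β σ σ.2) (Finset.mem_univ ⟨σ, hσ⟩)
    exact F.mono hσb (hβ σ hσ).1
  refine ⟨b, fun t => ⟨fun ht => WithTop.coe_le_coe.2 (hle t (hsub t ht)), fun ht =>
    hP b t (WithTop.coe_le_coe.1 ht) ?_⟩⟩
  rwa [hb]

open PersistenceModule in
/-- Persistent homology over a field has an interval decomposition: in a basis adapted to the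
cycles and the boundaries of all `X_t`, a basis vector spans an interval from the time at which it
becomes a cycle of `X_t` to the time at which it becomes a boundary. -/
theorem exists_isDiagram (k : Type v) [Field k] (q : ℕ) :
    ∃ D, (F.persistentHomology k q).IsDiagram D := by
  classical
  let Z (t : T) : Submodule k (X.cell → k) := X.relCycles k (F.sub t) ∅ q
  let B (t : T) : Submodule k (X.cell → k) := X.relBoundaries k (F.sub t) ∅ q
  have hZ {s t : T} (h : s ≤ t) : Z s ≤ Z t := relCycles_mono k (F.mono h) q
  have hB {s t : T} (h : s ≤ t) : B s ≤ B t := relBoundaries_mono k (F.mono h) q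
  obtain ⟨S, e, he⟩ := exists_basis_adapted (Monotone.isChain_range fun _ _ => hZ)
    (Monotone.isChain_range fun _ _ => hB)
  have heZ (t : T) := he (Z t) (Or.inl ⟨t, rfl⟩)
  have heB (t : T) := he (B t) (Or.inr ⟨t, rfl⟩)
  choose β hβ using fun i : S => F.exists_forall_iff_le
    (fun A => e i ∈ X.relCycles k A ∅ q) fun _ _ h h' => hZ h h'
  choose δ hδ using fun i : S => F.exists_forall_iff_le
    (fun A => e i ∈ X.relBoundaries k A ∅ q) fun _ _ h h' => hB h h'
  have : Finite S := Module.Finite.finite_basis e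
  have : Fintype {i // β i < δ i} := Fintype.ofFinite _
  let ε := (Fintype.equivFin {i // β i < δ i}).symm
  let b (j) : T := (β (ε j)).untop (ε j).2.ne_top
  let d (j) : WithTop T := δ (ε j)
  have hb (j) : (b j : WithTop T) = β (ε j) := WithTop.coe_untop _ _
  have hbt (j) (t : T) : b j ≤ t ↔ e (ε j) ∈ Z t := by
    rw [← WithTop.coe_le_coe, hb]
    exact (hβ _ t).symm
  have hdt (j) (t : T) : (t : WithTop T) < d j ↔ e (ε j) ∉ B t := by
    rw [← not_le]
    exact not_congr (hδ _ t).symm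
  let Φ (t : T) : Z t →ₗ[k] ∀ j, intervalSpace k (b j) (d j) t := LinearMap.pi fun j =>
    (intervalProj k (b j) (d j) t).comp ((e.coord (ε j)).comp (Z t).subtype)
  have hΦ (t : T) (z : Z t) (j) : Φ t z j = intervalProj k (b j) (d j) t (e.repr z (ε j)) := rfl
  have hker (t : T) : (B t).submoduleOf (Z t) = LinearMap.ker (Φ t) := by
    ext z
    rw [LinearMap.mem_ker]
    constructor
    · intro hz
      funext j
      refine Subtype.ext ?_
      rw [hΦ]
      by_cases h : b j ≤ t ∧ (t : WithTop T) < d j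
      · rw [coe_intervalProj_of_mem h]
        by_contra hne
        exact (hdt j t).1 h.2 (heB t z hz _ hne)
      · exact coe_intervalProj_of_notMem h _
    · intro hz
      change (z : X.cell → k) ∈ B t
      rw [← e.linearCombination_repr z]
      refine Submodule.sum_mem _ fun i _ => ?_
      by_cases hi : e.repr (z : X.cell → k) i = 0
      · simp [hi]
      refine Submodule.smul_mem _ _ ?_
      by_contra hiB
      have hiZ : e i ∈ Z t := heZ t z z.2 i hi
      have hlt : β i < δ i := ((hβ i t).1 hiZ).trans_lt (not_le.1 fun h => hiB ((hδ i t).2 h))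
      obtain ⟨j, hj⟩ := ε.surjective ⟨i, hlt⟩
      have hj' : ((ε j : {i // β i < δ i}) : S) = i := congrArg Subtype.val hj
      have h0 := congrArg Subtype.val (congrFun hz j)
      rw [hΦ, coe_intervalProj_of_mem ⟨(hbt j t).2 (hj' ▸ hiZ), (hdt j t).2 (hj' ▸ hiB)⟩,
        hj'] at h0
      exact hi h0
  have hsurj (t : T) : Function.Surjective (Φ t) := by
    intro f
    have hmem : ∑ j, (f j : k) • e (ε j) ∈ Z t := by
      refine sum_mem fun j _ => ?_
      by_cases h : b j ≤ t ∧ (t : WithTop T) < d j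
      · exact Submodule.smul_mem _ _ ((hbt j t).1 h.1)
      · rw [coe_eq_zero_of_notMem h, zero_smul]
        exact zero_mem _
    refine ⟨⟨_, hmem⟩, funext fun j => Subtype.ext ?_⟩
    have hrepr : e.repr (∑ j, (f j : k) • e (ε j)) (ε j) = f j := by
      rw [map_sum, Finsupp.finsetSum_apply, Finset.sum_eq_single j]
      · simp
      · intro j' _ hne
        have : ((ε j' : {i // β i < δ i}) : S) ≠ ε j := fun h =>
          hne (ε.injective (Subtype.ext h))
        simp [this]
      · simp
    rw [hΦ, hrepr]
    by_cases h : b j ≤ t ∧ (t : WithTop T) < d j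
    · rw [coe_intervalProj_of_mem h]
    · rw [coe_intervalProj_of_notMem h, coe_eq_zero_of_notMem h]
  refine ⟨_, _, b, d, fun j => ⟨?_, ?_⟩, rfl, ⟨⟨fun t =>
    ((Submodule.quotEquivOfEq _ _ (hker t)).trans
      ((Φ t).quotKerEquivOfSurjective (hsurj t))).trans
      (DirectSum.linearEquivFunOnFintype k _ _).symm, fun {s t} hst x => ?_⟩⟩⟩
  · -- A basis vector is not zero, hence not a chain of `X_0 = ∅`.
    rw [bot_lt_iff_ne_bot]
    intro hj
    have h0 := (hbt j ⊥).1 hj.le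
    simp only [Z, F.sub_bot, relCycles_empty, chains_empty, bot_inf_eq, Submodule.mem_bot] at h0
    exact e.ne_zero _ h0
  · rw [hb]
    exact (ε j).2
  · obtain ⟨z, rfl⟩ := Submodule.Quotient.mk_surjective _ x
    refine DFinsupp.ext fun j => ?_
    refine (intervalMap_intervalProj hst fun h => ?_).symm
    by_contra hne
    exact h ((hbt j s).2 (heZ s z z.2 _ hne))

end CellComplex.Filtration

/-! ### Comparing coefficients -/

namespace CellComplex

variable {X : CellComplex.{u}}

/-- Freeness of relative homology says that the rank of the relative boundaries does not drop
modulo any prime. -/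
theorem free_relHomology_iff {A B : Set X.cell} (hA : X.IsSubcomplex A) (hB : X.IsSubcomplex B)
    (h : A ⊆ B) (q : ℕ) :
    Module.Free ℤ (X.RelHomology ℤ B A q) ↔ ∀ (p : ℕ) [Fact p.Prime],
      Module.finrank (ZMod p) (X.relBoundaries (ZMod p) B A q) =
        Module.finrank ℤ (X.relBoundaries ℤ B A q) := by
  rw [Submodule.free_quotient_submoduleOf_iff (relBoundaries_le_relCycles ℤ hA hB h q)
    fun n c hn => mem_relCycles_of_smul_mem hn]
  refine forall₂_congr fun p _ => ?_
  rw [← Submodule.finrank_spanCast_zmod_iff, ← relBoundaries_eq_spanCast]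

theorem finrank_relBoundaries_of_charZero (k : Type v) [Field k] [CharZero k]
    (A B : Set X.cell) (q : ℕ) :
    Module.finrank k (X.relBoundaries k B A q) = Module.finrank ℤ (X.relBoundaries ℤ B A q) := by
  rw [relBoundaries_eq_spanCast, Submodule.finrank_spanCast_of_charZero]

namespace Filtration

variable {T : Type w} [LinearOrder T] [OrderBot T] (F : X.Filtration T)

/-- In degrees up to `M`, two fields give the same ranks of the maps `H_q(X_s) → H_q(X_t)` exactly
if they give the same ranks of the relative boundaries of the pairs `(X_t, X_s)`. -/
theorem finrank_range_homologyMap_eq_iff (k : Type*) [Field k] (k' : Type*) [Field k'] (M : ℕ) :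
    (∀ q ≤ M, ∀ (s t : T) (hst : s ≤ t),
      Module.finrank k (LinearMap.range (homologyMap k (F.mono hst) q)) =
        Module.finrank k' (LinearMap.range (homologyMap k' (F.mono hst) q))) ↔
    ∀ q ≤ M, ∀ s t : T, s ≤ t →
      Module.finrank k (X.relBoundaries k (F.sub t) (F.sub s) q) =
        Module.finrank k' (X.relBoundaries k' (F.sub t) (F.sub s) q) := by
  constructor
  · intro h
    have hz (q) (hq : q ≤ M + 1) (t : T) :
        Module.finrank k ((X.chains k (F.sub t) q).map (X.boundary k)) =
          Module.finrank k' ((X.chains k' (F.sub t) q).map (X.boundary k')) := by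
      induction q with
      | zero => rw [map_boundary_chains_zero, map_boundary_chains_zero, finrank_bot, finrank_bot]
      | succ q ih =>
        have h1 := finrank_range_homologyMap k (F.mono (le_refl t)) q
        have h2 := finrank_range_homologyMap k' (F.mono (le_refl t)) q
        rw [finrank_relBoundaries_self _ (F.isSubcomplex t)] at h1 h2
        rw [← relBoundaries_empty, ← relBoundaries_empty]
        have h3 := ih (by omega)
        have h4 := h q (by omega) t t le_rfl
        omega
    intro q hq s t hst
    have h1 := finrank_range_homologyMap k (F.mono hst) q
    have h2 := finrank_range_homologyMap k' (F.mono hst) q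
    have h3 := h q hq s t hst
    have h4 := hz q (by omega) s
    have h5 := hz (q + 1) (by omega) t
    rw [← relBoundaries_empty, ← relBoundaries_empty] at h5
    omega
  · intro h q hq s t hst
    have hz (q) (hq : q ≤ M) (t : T) :
        Module.finrank k (X.relBoundaries k (F.sub t) ∅ q) =
          Module.finrank k' (X.relBoundaries k' (F.sub t) ∅ q) := by
      rw [← F.sub_bot]
      exact h q hq ⊥ t bot_le
    have h1 := finrank_range_homologyMap k (F.mono hst) q
    have h2 := finrank_range_homologyMap k' (F.mono hst) q
    have h3 := h q hq s t hst
    have h4 := hz q hq t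
    cases q with
    | zero =>
      rw [map_boundary_chains_zero, finrank_bot] at h1 h2
      omega
    | succ q =>
      have h5 := hz q (by omega) s
      rw [← relBoundaries_empty] at h1 h2
      omega

/-- If two fields give the same ranks of relative boundaries, they give the same diagrams. -/
theorem isDiagram_of_finrank_relBoundaries_eq {k : Type*} [Field k] {k' : Type*} [Field k']
    {M : ℕ} (h : ∀ q ≤ M, ∀ s t : T, s ≤ t →
      Module.finrank k (X.relBoundaries k (F.sub t) (F.sub s) q) =
        Module.finrank k' (X.relBoundaries k' (F.sub t) (F.sub s) q))
    {q : ℕ} (hq : q ≤ M) {D : Multiset (T × WithTop T)}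
    (hD : (F.persistentHomology k q).IsDiagram D) : (F.persistentHomology k' q).IsDiagram D := by
  obtain ⟨D', hD'⟩ := F.exists_isDiagram k' q
  rwa [hD.eq_of_finrank_eq hD' fun s t hst =>
    (F.finrank_range_homologyMap_eq_iff k k' M).2 h q hq s t hst]

end Filtration

end CellComplex

theorem corollary3 (X : CellComplex.{u}) (T : Type w) [LinearOrder T] [OrderBot T]
    (F : X.Filtration T) (M : ℕ) :
    (∀ q ≤ M, F.DiagramIndependent q) ↔
      ∀ q ≤ M, ∀ m n : T, m < n →
        Module.Free ℤ (X.RelHomology ℤ (F.sub n) (F.sub m) q) := by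
  constructor
  · intro h q hq m n hmn
    refine (CellComplex.free_relHomology_iff (F.isSubcomplex m) (F.isSubcomplex n)
      (F.mono hmn.le) q).2 fun p _ => ?_
    rw [← CellComplex.finrank_relBoundaries_of_charZero ℚ]
    refine (F.finrank_range_homologyMap_eq_iff (ZMod p) ℚ M).1 (fun q hq s t hst => ?_)
      q hq m n hmn.le
    obtain ⟨D, -, -, hQ, hp⟩ := h q hq
    exact ((hp p).finrank_range_map hst).trans (hQ.finrank_range_map hst).symm
  · intro h q hq
    have hchar (k : Type) [Field k] [CharZero k] : ∀ q ≤ M, ∀ s t : T, s ≤ t →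
        Module.finrank ℚ (X.relBoundaries ℚ (F.sub t) (F.sub s) q) =
          Module.finrank k (X.relBoundaries k (F.sub t) (F.sub s) q) := fun q _ s t _ => by
      rw [CellComplex.finrank_relBoundaries_of_charZero,
        CellComplex.finrank_relBoundaries_of_charZero]
    have hmod (p : ℕ) [Fact p.Prime] : ∀ q ≤ M, ∀ s t : T, s ≤ t →
        Module.finrank ℚ (X.relBoundaries ℚ (F.sub t) (F.sub s) q) =
          Module.finrank (ZMod p) (X.relBoundaries (ZMod p) (F.sub t) (F.sub s) q) := by
      intro q hq s t hst
      rcases hst.eq_or_lt with rfl | hlt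
      · rw [CellComplex.finrank_relBoundaries_self _ (F.isSubcomplex s),
          CellComplex.finrank_relBoundaries_self _ (F.isSubcomplex s)]
      · rw [CellComplex.finrank_relBoundaries_of_charZero]
        exact ((CellComplex.free_relHomology_iff (F.isSubcomplex s) (F.isSubcomplex t)
          (F.mono hst) q).1 (h q hq s t hlt) p).symm
    obtain ⟨D, hD⟩ := F.exists_isDiagram ℚ q
    exact ⟨D, F.isDiagram_of_finrank_relBoundaries_eq (hchar ℂ) hq hD,
      F.isDiagram_of_finrank_relBoundaries_eq (hchar ℝ) hq hD, hD,
      fun p _ => F.isDiagram_of_finrank_relBoundaries_eq (hmod p) hq hD⟩
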